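/- For each sample size $n$ let $p=p_n$ be a positive integer, let $X_{ij}$ ($1\le i\le n$, $1\le j\le p$) and $\varepsilon_i$ ($1\le i\le n$) be mutually independent standard normal random variables (all depending on $n$), and write $\mathbf X_j=(X_{1j},\dots,X_{nj})^T$ and $\boldsymbol\varepsilon=(\varepsilon_1,\dots,\varepsilon_n)^T$. Let $$\hat\gamma_n=\max_{1\le j\le p}\bigl|\widehat{\mathrm{corr}}_n(\mathbf X_j,\boldsymbol\varepsilon)\bigr|$$ be the maximum absolute (Pearson) sample correlation, where $$\widehat{\mathrm{corr}}_n(\mathbf u,\mathbf v)=\frac{\sum_i(u_i-\bar u)(v_i-\bar v)}{\sqrt{\sum_i(u_i-\bar u)^2}\,\sqrt{\sum_i(v_i-\bar v)^2}}.$$ Suppose that $p_n\to\infty$ and $\log p_n=o(n^{1/2})$ as $n\to\infty$. Then $$\hat\gamma_n=\sqrt{\frac{2\log p}{n}}\,\{1+o_P(1)\},$$ and $\sqrt{2\log(2p)}\,(\sqrt n\,\hat\gamma_n-d_{2p})$ converges in distribution to the Gumbel law: for every $x\in\mathbb R$, $$P\Bigl\{\sqrt{2\log (2p)}\,\bigl(\sqrt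 n\,\hat\gamma_n-d_{2p}\bigr)<x\Bigr\}\longrightarrow\exp\{-\exp(-x)\}\qquad(n\to\infty),$$ where $d_q=\sqrt{2\log q}-\dfrac{\log\sqrt{4\pi\log q}}{\sqrt{2\log q}}$. -/

import Mathlib

open MeasureTheory ProbabilityTheory Filter Topology Asymptotics

noncomputable section

/-- The sample mean of `n` observations. -/
def sampleMean {n : ℕ} (u : Fin n → ℝ) : ℝ :=
  (∑ i, u i) / n

/-- The (Pearson) sample correlation of two vectors of `n` observations. -/
def sampleCorr {n : ℕ} (u v : Fin n → ℝ) : ℝ :=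
  (∑ i, (u i - sampleMean u) * (v i - sampleMean v)) /
    (Real.sqrt (∑ i, (u i - sampleMean u) ^ 2) * Real.sqrt (∑ i, (v i - sampleMean v) ^ 2))

/-- The maximum absolute sample correlation between the noise vector `e` and the `p` columns
`X_1, …, X_p` of the design matrix `x` (rows are observations, columns are covariates). -/
def maxAbsCorr {n p : ℕ} (x : Fin n → Fin p → ℝ) (e : Fin n → ℝ) : ℝ :=
  ⨆ j : Fin p, |sampleCorr (fun i => x i j) e|

/-- The Gaussian null setting: the `n * p` entries of the design matrix and the `n` noise
variables are mutually independent, each with the standard normal distribution. -/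
structure IsGaussianNull {Ω : Type*} [MeasurableSpace Ω] {n p : ℕ}
    (X : Fin n → Fin p → Ω → ℝ) (ε : Fin n → Ω → ℝ) (P : Measure Ω) : Prop where
  hasLaw_design : ∀ i j, HasLaw (X i j) (gaussianReal 0 1) P
  hasLaw_noise : ∀ i, HasLaw (ε i) (gaussianReal 0 1) P
  indep : iIndepFun (Sum.elim (fun ij : Fin n × Fin p => X ij.1 ij.2) ε) P

/-- The statistic `γ̂` as a random variable: the maximum absolute sample correlation between the
noise and the covariates. -/
def spuriousCorr {Ω : Type*} {n p : ℕ}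
    (X : Fin n → Fin p → Ω → ℝ) (ε : Fin n → Ω → ℝ) (ω : Ω) : ℝ :=
  maxAbsCorr (fun i j => X i j ω) (fun i => ε i ω)

/-- `R_n = o_P(1)`: the random variables `R n`, each living on its own probability space
`(Ω n, P n)`, converge to zero in probability. -/
def IsLittleOPOne {Ω : ℕ → Type*} [∀ n, MeasurableSpace (Ω n)]
    (P : ∀ n, Measure (Ω n)) (R : ∀ n, Ω n → ℝ) : Prop :=
  (∀ n, AEMeasurable (R n) (P n)) ∧
    ∀ δ : ℝ, 0 < δ → Tendsto (fun n => (P n).real {ω | δ ≤ |R n ω|}) atTop (𝓝 0)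

/-- The centering `d_q = √(2 log q) - log √(4 π log q) / √(2 log q)`. -/
def gumbelCentering (q : ℝ) : ℝ :=
  Real.sqrt (2 * Real.log q) -
    Real.log (Real.sqrt (4 * Real.pi * Real.log q)) / Real.sqrt (2 * Real.log q)

end

/-! Fix the noise vector `e`, not constant. Centering removes the direction of the all-ones vector,
and the sample correlation with `e` is the cosine of the angle between the centered column and the
centered `e`. By rotation invariance a Gaussian column has independent standard normal coordinates
in an orthonormal basis starting with these two directions, so its correlation is distributed as `z
/ ‖(z, w)‖` with `z` scalar and `w` standard normal in dimension `n - 2`. This law does not depend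
on `e`. Hence the `p` correlations behave as independent and identically distributed variables, and
P(γ̂ < t) = (1 - F)^p holds exactly (`IsGaussianNull.measureReal_spuriousCorr_lt`), where F = P(|z|
≥ c‖w‖) and c = t / √(1 - t²).

Integrating Mills-ratio bounds for the normal tail against the radial density of `w` encloses F
between multiples of an explicit Gamma-function expression (`radialTail_le`, `le_radialTail`). For t
= s/√n the only delicate factor is (1 - s²/n)^((n-2)/2). It is asymptotic to exp(-s²/2) when s⁴/n →
0, which log p = o(√n) guarantees for s of order √(2 log p) (`tendsto_one_sub_rpow_mul_exp`). Thus F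
is asymptotic to the two-sided normal tail 2 exp(-s²/2) / (√(2π) s). The Gumbel threshold makes pF →
exp(-x) (`tendsto_mul_corrTail`), and (1 - F)^p → exp(-exp(-x)).

The first-order claim follows from the Gumbel limit: the normalized maximum is tight, and any two
Gumbel thresholds are both asymptotic to √(2 log p). -/

/-! ### Gaussian vectors: density and radial integrals -/

/-- The standard Gaussian measure has the density `(2π)^{-d/2} exp (-‖x‖² / 2)`. -/
theorem stdGaussian_eq_withDensity {E : Type*} [NormedAddCommGroup E] [InnerProductSpace ℝ E]
    [FiniteDimensional ℝ E] [MeasurableSpace E] [BorelSpace E] :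
    stdGaussian E = volume.withDensity (fun x : E => ENNReal.ofReal
      ((2 * Real.pi) ^ (-(Module.finrank ℝ E / 2 : ℝ)) * Real.exp (-(1 / 2) * ‖x‖ ^ 2))) := by
  set C : ℝ := (2 * Real.pi) ^ (-(Module.finrank ℝ E / 2 : ℝ)) with hC
  have hCpos : 0 < C := by positivity
  have hpi : (Real.pi / (1 / 2)) = 2 * Real.pi := by ring
  have hint : Integrable (fun x : E => C * Real.exp (-(1 / 2) * ‖x‖ ^ 2)) := by
    have h := (GaussianFourier.integrable_cexp_neg_mul_sq_norm_add (V := E) (b := 1 / 2)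
      (by norm_num) 0 0).norm
    refine Integrable.const_mul (h.congr (ae_of_all _ fun x => ?_)) C
    simp only [Complex.norm_exp]
    congr 1
    simp [← Complex.ofReal_pow]
  have hfin : IsFiniteMeasure (volume.withDensity (fun x : E => ENNReal.ofReal
      (C * Real.exp (-(1 / 2) * ‖x‖ ^ 2)))) := isFiniteMeasure_withDensity_ofReal hint.2
  -- Finite measures are determined by their characteristic functions; that of the density is a
  -- Gaussian integral with a linear term.
  apply Measure.ext_of_charFun
  ext t
  rw [charFun_stdGaussian, charFun_apply]
  have hmeas : Measurable (fun x : E => (C * Real.exp (-(1 / 2) * ‖x‖ ^ 2)).toNNReal) := by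
    fun_prop
  have h1 := integral_withDensity_eq_integral_smul (μ := (volume : Measure E)) hmeas
    (fun x : E => Complex.exp (inner ℝ x t * Complex.I))
  have h2 := GaussianFourier.integral_cexp_neg_mul_sq_norm_add (V := E) (b := 1 / 2)
      (by norm_num) Complex.I t
  have h3 : ∀ x : E, (C * Real.exp (-(1 / 2) * ‖x‖ ^ 2)).toNNReal •
      Complex.exp (inner ℝ x t * Complex.I) = (C : ℂ) *
      Complex.exp (-(1 / 2) * ‖x‖ ^ 2 + Complex.I * inner ℝ t x) := by
    intro x
    rw [NNReal.smul_def, Real.coe_toNNReal _ (by positivity), Complex.real_smul, Complex.exp_add,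
      real_inner_comm]
    push_cast
    ring_nf
  simp only [h3] at h1
  rw [integral_const_mul, h2] at h1
  refine Eq.trans ?_ h1.symm
  rw [← mul_assoc]
  have h4 : (C : ℂ) * ((Real.pi : ℂ) / (1 / 2)) ^ ((Module.finrank ℝ E : ℂ) / 2) = 1 := by
    have : ((Real.pi : ℂ) / (1 / 2)) ^ ((Module.finrank ℝ E : ℂ) / 2) =
        (((2 * Real.pi) ^ (Module.finrank ℝ E / 2 : ℝ) : ℝ) : ℂ) := by
      rw [Complex.ofReal_cpow (by positivity)]
      push_cast
      congr 1
      ring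
    rw [this, ← Complex.ofReal_mul, hC, ← Real.rpow_add (by positivity)]
    simp
  rw [h4, one_mul]
  congr 1
  rw [Complex.I_sq]
  ring

/-- Integrating a function of the Euclidean norm against `k` independent standard normals. -/
theorem integral_pi_gaussianReal_radial {k : ℕ} (hk : 1 ≤ k) (f : ℝ → ℝ) :
    ∫ w, f (√(∑ i, w i ^ 2)) ∂(Measure.pi fun _ : Fin k => gaussianReal 0 1) =
      (∫ r in Set.Ioi (0 : ℝ), r ^ (k - 1) * Real.exp (-(1 / 2) * r ^ 2) * f r) /
        ∫ r in Set.Ioi (0 : ℝ), r ^ (k - 1) * Real.exp (-(1 / 2) * r ^ 2) := by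
  have : Nonempty (Fin k) := ⟨⟨0, hk⟩⟩
  -- The constant is independent of `f`, so the case `f = 1` later identifies it as the inverse of
  -- the normalizing integral, with no need to evaluate the volume of the ball.
  obtain ⟨C, hC⟩ : ∃ C : ℝ, ∀ f : ℝ → ℝ,
      ∫ w, f (√(∑ i, w i ^ 2)) ∂(Measure.pi fun _ : Fin k => gaussianReal 0 1) =
      C * ∫ r in Set.Ioi (0 : ℝ), r ^ (k - 1) * Real.exp (-(1 / 2) * r ^ 2) * f r := by
    refine ⟨k * volume.real (Metric.ball (0 : EuclideanSpace ℝ (Fin k)) 1) *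
      (2 * Real.pi) ^ (-(k / 2 : ℝ)), fun f => ?_⟩
    have h1 : ∫ w, f (√(∑ i, w i ^ 2)) ∂(Measure.pi fun _ : Fin k => gaussianReal 0 1) =
        ∫ v, f ‖v‖ ∂(stdGaussian (EuclideanSpace ℝ (Fin k))) := by
      rw [← map_pi_eq_stdGaussian,
        show (WithLp.toLp 2 : (Fin k → ℝ) → EuclideanSpace ℝ (Fin k)) =
          MeasurableEquiv.toLp 2 (Fin k → ℝ) from rfl,
        (MeasurableEquiv.toLp 2 (Fin k → ℝ)).measurableEmbedding.integral_map]
      simp [EuclideanSpace.norm_eq]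
    have hmeas : Measurable (fun x : EuclideanSpace ℝ (Fin k) =>
        ((2 * Real.pi) ^ (-(Module.finrank ℝ (EuclideanSpace ℝ (Fin k)) / 2 : ℝ)) *
          Real.exp (-(1 / 2) * ‖x‖ ^ 2)).toNNReal) := by
      fun_prop
    have h2 := integral_withDensity_eq_integral_smul
      (μ := (volume : Measure (EuclideanSpace ℝ (Fin k)))) hmeas (fun v => f ‖v‖)
    rw [h1, stdGaussian_eq_withDensity]
    refine h2.trans ?_
    have h3 := integral_fun_norm_addHaar (volume : Measure (EuclideanSpace ℝ (Fin k)))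
      (fun r => ((2 * Real.pi) ^ (-(Module.finrank ℝ (EuclideanSpace ℝ (Fin k)) / 2 : ℝ)) *
          Real.exp (-(1 / 2) * r ^ 2)).toNNReal • f r)
    refine h3.trans ?_
    have h4 : ∀ r : ℝ, r ^ (Module.finrank ℝ (EuclideanSpace ℝ (Fin k)) - 1) •
        (((2 * Real.pi) ^ (-(Module.finrank ℝ (EuclideanSpace ℝ (Fin k)) / 2 : ℝ)) *
          Real.exp (-(1 / 2) * r ^ 2)).toNNReal • f r) =
        (2 * Real.pi) ^ (-(k / 2 : ℝ)) *
          (r ^ (k - 1) * Real.exp (-(1 / 2) * r ^ 2) * f r) := by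
      intro r
      rw [NNReal.smul_def, Real.coe_toNNReal _ (by positivity)]
      simp only [smul_eq_mul, finrank_euclideanSpace, Fintype.card_fin]
      ring
    simp only [h4]
    rw [integral_const_mul]
    simp only [nsmul_eq_mul, smul_eq_mul, finrank_euclideanSpace, Fintype.card_fin]
    ring
  have h1 := hC (fun _ => 1)
  simp only [mul_one, integral_const, probReal_univ, smul_eq_mul] at h1
  have h0 : (∫ r in Set.Ioi (0 : ℝ), r ^ (k - 1) * Real.exp (-(1 / 2) * r ^ 2)) ≠ 0 := by
    intro h
    rw [h] at h1
    simp at h1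
  rw [hC, eq_div_iff h0]
  linear_combination (-(∫ r in Set.Ioi (0 : ℝ),
    r ^ (k - 1) * Real.exp (-(1 / 2) * r ^ 2) * f r)) * h1

/-! ### Mills-ratio bounds for the normal tail -/

/-- The two-sided tail of the standard normal distribution. -/
noncomputable def gaussTail (y : ℝ) : ℝ := (gaussianReal 0 1).real {z | y ≤ |z|}

theorem gaussTail_eq_integral {y : ℝ} (hy : 0 < y) :
    gaussTail y = 2 * ∫ z in Set.Ioi y, (√(2 * Real.pi))⁻¹ * Real.exp (-z ^ 2 / 2) := by
  have h1 : {z : ℝ | y ≤ |z|} = Set.Ici y ∪ Set.Iic (-y) := by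
    ext z
    simp only [Set.mem_ofPred_eq, le_abs, Set.mem_union, Set.mem_Ici, Set.mem_Iic]
    constructor <;> (rintro (h | h) <;> [left; right] <;> linarith)
  have hd : Disjoint (Set.Ici y) (Set.Iic (-y)) := by
    rw [Set.disjoint_left]
    intro z h h'
    simp only [Set.mem_Ici, Set.mem_Iic] at h h'
    linarith
  have h2 : (gaussianReal 0 1).real (Set.Iic (-y)) = (gaussianReal 0 1).real (Set.Ici y) := by
    have h : (gaussianReal 0 1).map (fun x => -x) = gaussianReal 0 1 := by
      rw [gaussianReal_map_neg, neg_zero]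
    conv_lhs => rw [← h]
    rw [map_measureReal_apply measurable_neg measurableSet_Iic]
    congr 1
    ext z
    simp
  have h3 : (gaussianReal 0 1).real (Set.Ici y) =
      ∫ z in Set.Ioi y, (√(2 * Real.pi))⁻¹ * Real.exp (-z ^ 2 / 2) := by
    rw [measureReal_def, gaussianReal_apply_eq_integral 0 one_ne_zero,
      ENNReal.toReal_ofReal (integral_nonneg fun _ => gaussianPDFReal_nonneg _ _ _),
      integral_Ici_eq_integral_Ioi]
    simp [gaussianPDFReal]
  rw [gaussTail, h1, measureReal_union hd measurableSet_Iic, h2, h3]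
  ring

theorem integrableOn_gaussian (y : ℝ) :
    IntegrableOn (fun z : ℝ => Real.exp (-z ^ 2 / 2)) (Set.Ioi y) := by
  have := (integrable_exp_neg_mul_sq (b := 1 / 2) (by norm_num)).integrableOn (s := Set.Ioi y)
  refine this.congr_fun (fun z _ => ?_) measurableSet_Ioi
  simp only []
  ring_nf

theorem tendsto_exp_neg_sq_half : Tendsto (fun z : ℝ => Real.exp (-z ^ 2 / 2)) atTop (𝓝 0) := by
  refine Real.tendsto_exp_atBot.comp ?_
  have : Tendsto (fun z : ℝ => z ^ 2 / 2) atTop atTop :=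
    (tendsto_pow_atTop two_ne_zero).atTop_div_const (by norm_num)
  refine (tendsto_neg_atTop_atBot.comp this).congr fun z => ?_
  simp only [Function.comp]
  ring

theorem hasDerivAt_exp_neg_sq_half (z : ℝ) :
    HasDerivAt (fun z : ℝ => Real.exp (-z ^ 2 / 2)) (-z * Real.exp (-z ^ 2 / 2)) z := by
  have := (((hasDerivAt_pow 2 z).neg).div_const 2).exp
  refine this.congr_deriv ?_
  simp only [Pi.neg_apply]
  push_cast
  ring_nf

/-- On z > y the factor z/y is at least 1, and inserting it turns the integrand into an exact
derivative. -/
theorem integral_gaussian_Ioi_le {y : ℝ} (hy : 0 < y) :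
    ∫ z in Set.Ioi y, Real.exp (-z ^ 2 / 2) ≤ Real.exp (-y ^ 2 / 2) / y := by
  have hd : ∀ z ∈ Set.Ici y, HasDerivAt (fun z : ℝ => -(Real.exp (-z ^ 2 / 2) / y))
      (z / y * Real.exp (-z ^ 2 / 2)) z := fun z _ => by
    refine (((hasDerivAt_exp_neg_sq_half z).div_const y).neg).congr_deriv ?_
    ring
  have hpos : ∀ z ∈ Set.Ioi y, 0 ≤ z / y * Real.exp (-z ^ 2 / 2) := fun z hz => by
    have : 0 < z := hy.trans hz
    positivity
  have ht : Tendsto (fun z : ℝ => -(Real.exp (-z ^ 2 / 2) / y)) atTop (𝓝 0) := by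
    simpa using (tendsto_exp_neg_sq_half.div_const y).neg
  have h := integral_Ioi_of_hasDerivAt_of_nonneg' hd hpos ht
  have hi := integrableOn_Ioi_deriv_of_nonneg' hd hpos ht
  rw [zero_sub, neg_neg] at h
  rw [← h]
  refine setIntegral_mono_on (integrableOn_gaussian y) hi measurableSet_Ioi fun z hz => ?_
  have : 1 ≤ z / y := (one_le_div hy).2 (le_of_lt hz)
  nlinarith [Real.exp_pos (-z ^ 2 / 2)]

/-- Multiplying the integrand by 1 - 3/z⁴ only decreases it, and the product has the antiderivative
-exp(-z²/2)(1/z - 1/z³). -/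
theorem le_integral_gaussian_Ioi {y : ℝ} (hy : 0 < y) :
    Real.exp (-y ^ 2 / 2) * (1 / y - 1 / y ^ 3) ≤ ∫ z in Set.Ioi y, Real.exp (-z ^ 2 / 2) := by
  have hd : ∀ z ∈ Set.Ici y, HasDerivAt
      (fun z : ℝ => -(Real.exp (-z ^ 2 / 2) * (z⁻¹ - (z ^ 3)⁻¹)))
      (Real.exp (-z ^ 2 / 2) - 3 / z ^ 4 * Real.exp (-z ^ 2 / 2)) z := fun z hz => by
    have hz0 : z ≠ 0 := (hy.trans_le hz).ne'
    have h3 : HasDerivAt (fun z : ℝ => (z ^ 3)⁻¹) (-(3 * z ^ 2) / (z ^ 3) ^ 2) z := by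
      have := (hasDerivAt_pow 3 z).fun_inv (by positivity)
      simpa using this
    refine (((hasDerivAt_exp_neg_sq_half z).mul
      ((hasDerivAt_inv hz0).sub h3)).neg).congr_deriv ?_
    simp only [Pi.sub_apply]
    field_simp
    ring
  have ht : Tendsto (fun z : ℝ => -(Real.exp (-z ^ 2 / 2) * (z⁻¹ - (z ^ 3)⁻¹))) atTop (𝓝 0) := by
    have h1 := tendsto_inv_atTop_zero (𝕜 := ℝ)
    have h2 := h1.comp (tendsto_pow_atTop (α := ℝ) (three_ne_zero))
    simpa using (tendsto_exp_neg_sq_half.mul (h1.sub h2)).neg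
  have hi : IntegrableOn (fun z : ℝ => 3 / z ^ 4 * Real.exp (-z ^ 2 / 2)) (Set.Ioi y) := by
    refine Integrable.bdd_mul (c := 3 / y ^ 4) (integrableOn_gaussian y)
      (Measurable.aestronglyMeasurable (by fun_prop)) ?_
    refine (ae_restrict_iff' measurableSet_Ioi).2 (ae_of_all _ fun z hz => ?_)
    have hz' : 0 < z := hy.trans hz
    rw [Real.norm_of_nonneg (by positivity)]
    have : y ≤ z := le_of_lt hz
    gcongr
  have h := integral_Ioi_of_hasDerivAt_of_tendsto' hd ((integrableOn_gaussian y).sub hi) ht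
  rw [zero_sub, neg_neg] at h
  rw [one_div, one_div, ← h]
  refine setIntegral_mono_on ((integrableOn_gaussian y).sub hi) (integrableOn_gaussian y)
    measurableSet_Ioi fun z hz => ?_
  have : 0 < z := hy.trans hz
  have : 0 ≤ 3 / z ^ 4 * Real.exp (-z ^ 2 / 2) := by positivity
  linarith

theorem gaussTail_le {y : ℝ} (hy : 0 < y) :
    gaussTail y ≤ 2 * (√(2 * Real.pi))⁻¹ * (Real.exp (-y ^ 2 / 2) / y) := by
  rw [gaussTail_eq_integral hy, integral_const_mul, ← mul_assoc]
  have := integral_gaussian_Ioi_le hy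
  gcongr

theorem le_gaussTail {y : ℝ} (hy : 0 < y) :
    2 * (√(2 * Real.pi))⁻¹ * (Real.exp (-y ^ 2 / 2) * (1 / y - 1 / y ^ 3)) ≤ gaussTail y := by
  rw [gaussTail_eq_integral hy, integral_const_mul, ← mul_assoc 2]
  exact mul_le_mul_of_nonneg_left (le_integral_gaussian_Ioi hy) (by positivity)

/-! ### Averaging the normal tail over the radius -/

theorem integral_pow_mul_exp_neg_mul_sq (q : ℕ) {b : ℝ} (hb : 0 < b) :
    ∫ r in Set.Ioi (0 : ℝ), r ^ q * Real.exp (-b * r ^ 2) =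
      b ^ (-((q : ℝ) + 1) / 2) * (1 / 2) * Real.Gamma (((q : ℝ) + 1) / 2) := by
  have h := integral_rpow_mul_exp_neg_mul_rpow (p := 2) (q := q) (b := b) two_pos
    (by have : (0 : ℝ) ≤ q := q.cast_nonneg
        linarith) hb
  rw [← h]
  refine setIntegral_congr_fun measurableSet_Ioi fun r _ => ?_
  simp only [Real.rpow_natCast, Real.rpow_two]

theorem integrableOn_pow_mul_exp_neg_mul_sq (q : ℕ) {b : ℝ} (hb : 0 < b) :
    IntegrableOn (fun r : ℝ => r ^ q * Real.exp (-b * r ^ 2)) (Set.Ioi 0) := by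
  have h := integrableOn_rpow_mul_exp_neg_mul_sq hb (s := q)
    (by have : (0 : ℝ) ≤ q := q.cast_nonneg
        linarith)
  refine h.congr_fun (fun r _ => ?_) measurableSet_Ioi
  simp only [Real.rpow_natCast]

theorem antitone_gaussTail : Antitone gaussTail := fun _ _ h =>
  measureReal_mono fun _ hz => le_trans h hz

theorem gaussTail_nonneg (y : ℝ) : 0 ≤ gaussTail y := measureReal_nonneg

theorem gaussTail_le_one (y : ℝ) : gaussTail y ≤ 1 := measureReal_le_one

/-- The expectation of `gaussTail (c * ‖w‖)` for a standard normal vector `w` in dimension `k`. -/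
noncomputable def radialTail (k : ℕ) (c : ℝ) : ℝ :=
  ∫ w, gaussTail (c * √(∑ i, w i ^ 2)) ∂(Measure.pi fun _ : Fin k => gaussianReal 0 1)

/-- The leading term of `radialTail (m + 4) c`. -/
noncomputable def radialTailMain (m : ℕ) (c : ℝ) : ℝ :=
  (√Real.pi)⁻¹ * c⁻¹ * (1 + c ^ 2) ^ (-((m : ℝ) + 3) / 2) *
    (Real.Gamma (((m : ℝ) + 3) / 2) / Real.Gamma (((m : ℝ) + 4) / 2))

theorem radialTail_eq (m : ℕ) (c : ℝ) :
    radialTail (m + 4) c =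
      (∫ r in Set.Ioi (0 : ℝ), r ^ (m + 3) * Real.exp (-(1 / 2) * r ^ 2) * gaussTail (c * r)) /
        ∫ r in Set.Ioi (0 : ℝ), r ^ (m + 3) * Real.exp (-(1 / 2) * r ^ 2) :=
  integral_pi_gaussianReal_radial (k := m + 4) (by omega) (fun r => gaussTail (c * r))

/-- Exhibits the Gamma-function expression as the radial average of the Mills upper bound, the form
in which integrands can be compared pointwise. -/
theorem radialTailMain_eq (m : ℕ) {c : ℝ} (hc : 0 < c) :
    radialTailMain m c =
      2 * (√(2 * Real.pi))⁻¹ * c⁻¹ *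
        (∫ r in Set.Ioi (0 : ℝ), r ^ (m + 2) * Real.exp (-((1 + c ^ 2) * (1 / 2)) * r ^ 2)) /
        ∫ r in Set.Ioi (0 : ℝ), r ^ (m + 3) * Real.exp (-(1 / 2) * r ^ 2) := by
  rw [integral_pow_mul_exp_neg_mul_sq _ (by positivity),
    integral_pow_mul_exp_neg_mul_sq _ (by positivity), radialTailMain]
  have hm : (0 : ℝ) ≤ m := m.cast_nonneg
  have e1 : ((m + 2 : ℕ) : ℝ) + 1 = m + 3 := by push_cast; ring
  have e2 : ((m + 3 : ℕ) : ℝ) + 1 = m + 4 := by push_cast; ring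
  rw [e1, e2, Real.mul_rpow (by positivity) (by positivity)]
  -- The powers of 1/2 from the two integrals differ by a factor √2, which turns √(2π) into √π.
  have e3 : ((1 : ℝ) / 2) ^ (-((m : ℝ) + 3) / 2) =
      (1 / 2) ^ (-((m : ℝ) + 4) / 2) * (√2)⁻¹ := by
    rw [show -((m : ℝ) + 3) / 2 = -((m : ℝ) + 4) / 2 + 1 / 2 by ring,
      Real.rpow_add (by positivity), ← Real.sqrt_eq_rpow, Real.sqrt_div zero_le_one]
    simp
  rw [e3, Real.sqrt_mul (by norm_num)]
  have hG : Real.Gamma (((m : ℝ) + 4) / 2) ≠ 0 := (Real.Gamma_pos_of_pos (by positivity)).ne'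
  have hp : ((1 : ℝ) / 2) ^ (-((m : ℝ) + 4) / 2) ≠ 0 := by positivity
  have h2 : √2 ^ 2 = (2 : ℝ) := Real.sq_sqrt (by norm_num)
  have hs : √Real.pi ≠ 0 := by positivity
  have hs2 : √(2 : ℝ) ≠ 0 := by positivity
  have hcn := hc.ne'
  generalize (1 / 2 : ℝ) ^ (-((m : ℝ) + 4) / 2) = A at *
  generalize (1 + c ^ 2) ^ (-((m : ℝ) + 3) / 2) = B at *
  field_simp
  rw [h2]

/-- This is Γ(s + 1) = sΓ(s); it makes the second-order Mills term an explicit multiple of the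
leading one. -/
theorem integral_pow_add_two (m : ℕ) {b : ℝ} (hb : 0 < b) :
    ∫ r in Set.Ioi (0 : ℝ), r ^ m * Real.exp (-b * r ^ 2) =
      (2 * b / (m + 1)) * ∫ r in Set.Ioi (0 : ℝ), r ^ (m + 2) * Real.exp (-b * r ^ 2) := by
  have hm : (0 : ℝ) ≤ m := m.cast_nonneg
  rw [integral_pow_mul_exp_neg_mul_sq _ hb, integral_pow_mul_exp_neg_mul_sq _ hb,
    show (((m + 2 : ℕ) : ℝ) + 1) / 2 = ((m : ℝ) + 1) / 2 + 1 by push_cast; ring,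
    show -(((m + 2 : ℕ) : ℝ) + 1) / 2 = -((m : ℝ) + 1) / 2 - 1 by push_cast; ring,
    Real.Gamma_add_one (by positivity), Real.rpow_sub_one hb.ne']
  field_simp

theorem integrableOn_mul_gaussTail (q : ℕ) (c : ℝ) {b : ℝ} (hb : 0 < b) :
    IntegrableOn (fun r : ℝ => r ^ q * Real.exp (-b * r ^ 2) * gaussTail (c * r))
      (Set.Ioi 0) := by
  refine Integrable.mul_bdd (c := 1) (integrableOn_pow_mul_exp_neg_mul_sq q hb) ?_ ?_
  · exact (antitone_gaussTail.measurable.comp (measurable_const_mul c)).aestronglyMeasurable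
  · refine ae_of_all _ fun r => ?_
    rw [Real.norm_of_nonneg (gaussTail_nonneg _)]
    exact gaussTail_le_one _

theorem exp_mul_exp_gauss (c r : ℝ) : Real.exp (-(1 / 2) * r ^ 2) * Real.exp (-(c * r) ^ 2 / 2) =
    Real.exp (-((1 + c ^ 2) * (1 / 2)) * r ^ 2) := by
  rw [← Real.exp_add]
  ring_nf

theorem radialTail_le (m : ℕ) {c : ℝ} (hc : 0 < c) :
    radialTail (m + 4) c ≤ radialTailMain m c := by
  rw [radialTail_eq, radialTailMain_eq m hc, ← integral_const_mul]
  refine div_le_div_of_nonneg_right ?_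
    (setIntegral_nonneg measurableSet_Ioi fun r (hr : 0 < r) => by positivity)
  refine setIntegral_mono_on (integrableOn_mul_gaussTail _ _ (by norm_num))
    ((integrableOn_pow_mul_exp_neg_mul_sq _ (by positivity)).const_mul _)
    measurableSet_Ioi fun r (hr : 0 < r) => ?_
  have h := gaussTail_le (mul_pos hc hr)
  rw [← exp_mul_exp_gauss]
  calc _ ≤ r ^ (m + 3) * Real.exp (-(1 / 2) * r ^ 2) *
        (2 * (√(2 * Real.pi))⁻¹ * (Real.exp (-(c * r) ^ 2 / 2) / (c * r))) := by gcongr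
    _ = _ := by
      field_simp
      ring

/-- The correction 1/(cr)³ lowers the power of r from m + 3 to m, which is why the dimension is
taken to be m + 4. The recursion `integral_pow_add_two` then converts the subtracted integral into
the stated relative loss. -/
theorem le_radialTail (m : ℕ) {c : ℝ} (hc : 0 < c) :
    radialTailMain m c * (1 - (1 + c ^ 2) / (c ^ 2 * (m + 1))) ≤ radialTail (m + 4) c := by
  have hm : (0 : ℝ) ≤ m := m.cast_nonneg
  have hb : 0 < (1 + c ^ 2) * (1 / 2) := by positivity
  have h1 := integral_pow_add_two m hb
  have key : radialTailMain m c * (1 - (1 + c ^ 2) / (c ^ 2 * (m + 1))) =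
      (∫ r in Set.Ioi (0 : ℝ),
        (2 * (√(2 * Real.pi))⁻¹ * c⁻¹ *
          (r ^ (m + 2) * Real.exp (-((1 + c ^ 2) * (1 / 2)) * r ^ 2)) -
        2 * (√(2 * Real.pi))⁻¹ * (c ^ 3)⁻¹ *
          (r ^ m * Real.exp (-((1 + c ^ 2) * (1 / 2)) * r ^ 2)))) /
        ∫ r in Set.Ioi (0 : ℝ), r ^ (m + 3) * Real.exp (-(1 / 2) * r ^ 2) := by
    rw [integral_sub ((integrableOn_pow_mul_exp_neg_mul_sq _ hb).const_mul _)
      ((integrableOn_pow_mul_exp_neg_mul_sq _ hb).const_mul _), integral_const_mul,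
      integral_const_mul, h1, radialTailMain_eq m hc, div_mul_eq_mul_div]
    congr 1
    field_simp
  rw [key, radialTail_eq]
  refine div_le_div_of_nonneg_right ?_
    (setIntegral_nonneg measurableSet_Ioi fun r (hr : 0 < r) => by positivity)
  refine setIntegral_mono_on
    (((integrableOn_pow_mul_exp_neg_mul_sq _ hb).const_mul _).sub
      ((integrableOn_pow_mul_exp_neg_mul_sq _ hb).const_mul _))
    (integrableOn_mul_gaussTail _ _ (by norm_num)) measurableSet_Ioi fun r (hr : 0 < r) => ?_
  have h := le_gaussTail (mul_pos hc hr)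
  rw [← exp_mul_exp_gauss]
  refine le_trans (le_of_eq ?_) (mul_le_mul_of_nonneg_left h
    (show 0 ≤ r ^ (m + 3) * Real.exp (-(1 / 2) * r ^ 2) by positivity))
  field_simp
  ring

/-! ### Sample correlation as a cosine -/

theorem sum_sub_sampleMean {n : ℕ} (u : Fin n → ℝ) : ∑ i, (u i - sampleMean u) = 0 := by
  rcases Nat.eq_zero_or_pos n with rfl | hn
  · simp
  · have : (n : ℝ) ≠ 0 := by positivity
    rw [Finset.sum_sub_distrib, sampleMean]
    simp only [Finset.sum_const, Finset.card_univ, Fintype.card_fin, nsmul_eq_mul]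
    field_simp
    ring

/-- In a suitable orthonormal basis, the sample correlation with a fixed non-constant vector is
a coordinate divided by the norm of all the coordinates but one. -/
theorem exists_orthonormalBasis_sampleCorr {k : ℕ} (e : Fin (k + 2) → ℝ)
    (he : ∑ i, (e i - sampleMean e) ^ 2 ≠ 0) :
    ∃ b : OrthonormalBasis (Fin (k + 2)) ℝ (EuclideanSpace ℝ (Fin (k + 2))),
      ∀ y : Fin (k + 2) → ℝ, sampleCorr (fun i => (∑ j, y j • b j) i) e =
        y 1 / √(y 1 ^ 2 + ∑ i : Fin k, y i.succ.succ ^ 2) := by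
  set n : ℝ := ((k + 2 : ℕ) : ℝ) with hn
  have hn0 : 0 < n := by positivity
  set d : EuclideanSpace ℝ (Fin (k + 2)) := WithLp.toLp 2 (fun i => e i - sampleMean e) with hd
  set v₀ : EuclideanSpace ℝ (Fin (k + 2)) := WithLp.toLp 2 (fun _ => (√n)⁻¹) with hv₀
  have hdsq : ‖d‖ ^ 2 = ∑ i, (e i - sampleMean e) ^ 2 := by
    rw [EuclideanSpace.real_norm_sq_eq]
  have hd0 : ‖d‖ ≠ 0 := fun h => he (by rw [← hdsq, h]; norm_num)
  have hv₀n : ‖v₀‖ = 1 := by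
    have : ‖v₀‖ ^ 2 = 1 := by
      rw [EuclideanSpace.real_norm_sq_eq]
      simp only [hv₀, inv_pow, Real.sq_sqrt hn0.le, Finset.sum_const, Finset.card_univ,
        Fintype.card_fin, nsmul_eq_mul]
      exact mul_inv_cancel₀ hn0.ne'
    nlinarith [norm_nonneg v₀]
  have hv₀i : ∀ x : EuclideanSpace ℝ (Fin (k + 2)), inner ℝ v₀ x = (√n)⁻¹ * ∑ i, x i := by
    intro x
    simp only [PiLp.inner_apply, hv₀, Finset.mul_sum]
    exact Finset.sum_congr rfl fun i _ => by simp [mul_comm]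
  have hdi : ∀ x : EuclideanSpace ℝ (Fin (k + 2)),
      inner ℝ d x = ∑ i, x i * (e i - sampleMean e) := by
    intro x
    simp [PiLp.inner_apply, hd]
  have hvd : inner ℝ v₀ d = 0 := by
    rw [hv₀i]
    simp only [hd]
    rw [sum_sub_sampleMean, mul_zero]
  -- Only the values at 0 and 1 matter: they are the normalized all-ones vector and the normalized
  -- centered `e`, and the rest of the basis is an arbitrary extension.
  let v : Fin (k + 2) → EuclideanSpace ℝ (Fin (k + 2)) :=
    fun i => if i = 0 then v₀ else ‖d‖⁻¹ • d
  have hu : ‖‖d‖⁻¹ • d‖ = 1 := by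
    rw [norm_smul, norm_inv, norm_norm, inv_mul_cancel₀ hd0]
  have hort : Orthonormal ℝ (({0, 1} : Set (Fin (k + 2))).domRestrict v) := by
    constructor
    · rintro ⟨i, hi⟩
      by_cases h : i = 0
      · simpa [v, h] using hv₀n
      · simpa [v, h] using hu
    · rintro ⟨i, hi⟩ ⟨j, hj⟩ hij
      have hij' : i ≠ j := fun h => hij (Subtype.ext h)
      simp only [Set.mem_insert_iff, Set.mem_singleton_iff] at hi hj
      rcases hi with rfl | rfl <;> rcases hj with rfl | rfl
      · exact absurd rfl hij'
      · simp [v, inner_smul_right, hvd]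
      · simp [v, inner_smul_left, real_inner_comm v₀ d, hvd]
      · exact absurd rfl hij'
  obtain ⟨b, hb⟩ := hort.exists_orthonormalBasis_extension_of_card_eq
    (ι := Fin (k + 2)) (by simp)
  have hb0 : b 0 = v₀ := by rw [hb 0 (by simp)]; simp [v]
  have hb1 : b 1 = ‖d‖⁻¹ • d := by rw [hb 1 (by simp)]; simp [v]
  refine ⟨b, fun y => ?_⟩
  set x := ∑ j, y j • b j with hx
  have hcoord : ∀ i, inner ℝ (b i) x = y i := fun i => by
    rw [hx, b.orthonormal.inner_right_fintype]
  have hnorm : ∑ i, x i ^ 2 = ∑ i, y i ^ 2 := by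
    rw [← EuclideanSpace.real_norm_sq_eq, ← b.sum_sq_inner_right]
    simp [hcoord]
  have h0 : ∑ i, x i = √n * y 0 := by
    have := hcoord 0
    rw [hb0, hv₀i] at this
    rw [← this]
    field_simp
  have h1 : ∑ i, x i * (e i - sampleMean e) = ‖d‖ * y 1 := by
    have := hcoord 1
    rw [hb1, inner_smul_left, hdi] at this
    rw [← this]
    simp only [conj_trivial]
    field_simp
  have hmean : sampleMean (fun i => x i) = (√n)⁻¹ * y 0 := by
    rw [sampleMean, h0, ← hn]
    field_simp
    rw [Real.sq_sqrt hn0.le, mul_comm]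
  have hnum : ∑ i, (x i - sampleMean (fun i => x i)) * (e i - sampleMean e) = ‖d‖ * y 1 := by
    simp only [sub_mul]
    rw [Finset.sum_sub_distrib, h1, ← Finset.mul_sum, sum_sub_sampleMean, mul_zero, sub_zero]
  have hden : ∑ i, (x i - sampleMean (fun i => x i)) ^ 2 =
      y 1 ^ 2 + ∑ i : Fin k, y i.succ.succ ^ 2 := by
    -- Centering is the projection orthogonal to the all-ones direction, so it deletes exactly the
    -- coordinate `y 0`.
    have h2 : ∑ i, (x i - sampleMean (fun i => x i)) ^ 2 = ∑ i, y i ^ 2 - y 0 ^ 2 := by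
      simp only [sub_sq, Finset.sum_add_distrib, Finset.sum_sub_distrib, ← Finset.mul_sum,
        ← Finset.sum_mul, Finset.sum_const, Finset.card_univ, Fintype.card_fin, nsmul_eq_mul]
      rw [hnorm, h0, hmean, ← hn, mul_pow, inv_pow, Real.sq_sqrt hn0.le]
      field_simp
      ring
    rw [h2, Fin.sum_univ_succ, Fin.sum_univ_succ]
    simp
  rw [sampleCorr, hnum, hden, ← hdsq, Real.sqrt_sq (norm_nonneg _)]
  rw [mul_comm (√_), mul_div_mul_left _ _ hd0]

/-! ### Law of a single sample correlation -/

/-- The standard normal pairs `(z, w)` in `ℝ × ℝᵏ` with `|z| / ‖(z, w)‖ < t`. -/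
def corrBody (k : ℕ) (t : ℝ) : Set (ℝ × (Fin k → ℝ)) :=
  {q | |q.1 / √(q.1 ^ 2 + ∑ i, q.2 i ^ 2)| < t}

theorem measurableSet_corrBody (k : ℕ) (t : ℝ) : MeasurableSet (corrBody k t) :=
  measurableSet_lt (by fun_prop) measurable_const

theorem measurable_sampleCorr {n : ℕ} :
    Measurable fun q : (Fin n → ℝ) × (Fin n → ℝ) => sampleCorr q.1 q.2 := by
  unfold sampleCorr sampleMean
  fun_prop

/-- Rotation invariance: the standard Gaussian has independent standard normal coordinates in the
basis adapted to `e`, so the right-hand side is free of `e`. -/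
theorem pi_gaussianReal_abs_sampleCorr_lt {k : ℕ} (e : Fin (k + 2) → ℝ)
    (he : ∑ i, (e i - sampleMean e) ^ 2 ≠ 0) (t : ℝ) :
    (Measure.pi fun _ : Fin (k + 2) => gaussianReal 0 1) {x | |sampleCorr x e| < t} =
      ((gaussianReal 0 1).prod (Measure.pi fun _ : Fin k => gaussianReal 0 1)) (corrBody k t) := by
  obtain ⟨b, hb⟩ := exists_orthonormalBasis_sampleCorr e he
  have hmeas : Measurable fun x : Fin (k + 2) → ℝ => sampleCorr x e :=
    measurable_sampleCorr.comp (measurable_id.prodMk measurable_const)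
  have hS : MeasurableSet {v : EuclideanSpace ℝ (Fin (k + 2)) |
      |sampleCorr (fun i => v i) e| < t} :=
    measurableSet_lt ((hmeas.comp (by fun_prop)).abs) measurable_const
  have h1 := Measure.map_apply (μ := Measure.pi fun _ : Fin (k + 2) => gaussianReal 0 1)
    (MeasurableEquiv.toLp 2 (Fin (k + 2) → ℝ)).measurable hS
  have h2 : (Measure.pi fun _ : Fin (k + 2) => gaussianReal 0 1).map
      (MeasurableEquiv.toLp 2 (Fin (k + 2) → ℝ)) =
      stdGaussian (EuclideanSpace ℝ (Fin (k + 2))) := map_pi_eq_stdGaussian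
  rw [h2, stdGaussian_eq_map_pi_orthonormalBasis b, Measure.map_apply (by fun_prop) hS] at h1
  refine h1.symm.trans ?_
  -- Split off and discard coordinate 0, then separate coordinate 1 from the remaining `k`.
  have hp1 := measurePreserving_piFinSuccAbove (fun _ : Fin (k + 2) => gaussianReal 0 1) 0
  have hp2 := measurePreserving_piFinSuccAbove (fun _ : Fin (k + 1) => gaussianReal 0 1) 0
  have hp3 := hp2.comp (measurePreserving_snd.comp hp1)
  have h3 := hp3.measure_preimage (measurableSet_corrBody k t).nullMeasurableSet
  rw [← h3]
  congr 1
  ext y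
  simp only [Set.mem_preimage, Set.mem_ofPred_eq, hb, corrBody, Function.comp]
  rfl

/-- A zero sum of squares forces the first two entries to agree, a null event because the normal law
has no atoms. -/
theorem pi_gaussianReal_sum_sub_sampleMean_ne {k : ℕ} :
    ∀ᵐ e ∂(Measure.pi fun _ : Fin (k + 2) => gaussianReal 0 1),
      ∑ i, (e i - sampleMean e) ^ 2 ≠ 0 := by
  have hna : NullSingletonClass (gaussianReal 0 1) := nullSingletonClass_gaussianReal one_ne_zero
  have hp1 := measurePreserving_piFinSuccAbove (fun _ : Fin (k + 2) => gaussianReal 0 1) 0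
  have hm : MeasurableSet {q : ℝ × (Fin (k + 1) → ℝ) | q.2 0 = q.1} :=
    measurableSet_eq_fun (by fun_prop) (by fun_prop)
  have h0 : ((gaussianReal 0 1).prod (Measure.pi fun _ : Fin (k + 1) => gaussianReal 0 1))
      {q : ℝ × (Fin (k + 1) → ℝ) | q.2 0 = q.1} = 0 := by
    rw [Measure.measure_prod_null hm]
    exact ae_of_all _ fun a =>
      Measure.pi_hyperplane (fun _ : Fin (k + 1) => gaussianReal 0 1) 0 a
  rw [← hp1.measure_preimage hm.nullMeasurableSet] at h0
  refine measure_mono_null (fun e he => ?_) h0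
  simp only [ne_eq, Set.mem_compl_iff, Set.mem_ofPred_eq, not_not] at he
  have := (Finset.sum_eq_zero_iff_of_nonneg (fun i _ => sq_nonneg _)).1 he
  have e0 := pow_eq_zero_iff two_ne_zero |>.1 (this 0 (Finset.mem_univ _))
  have e1 := pow_eq_zero_iff two_ne_zero |>.1 (this 1 (Finset.mem_univ _))
  change e 1 = e 0
  linarith

/-- A sample correlation with Gaussian data exceeds `t` with probability `radialTail`. -/
theorem prod_gaussianReal_corrBody {k : ℕ} (hk : 1 ≤ k) {t : ℝ} (ht0 : 0 < t) (ht1 : t < 1) :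
    ((gaussianReal 0 1).prod (Measure.pi fun _ : Fin k => gaussianReal 0 1)).real
      (corrBody k t) = 1 - radialTail k (t / √(1 - t ^ 2)) := by
  have hna : NullSingletonClass (gaussianReal 0 1) := nullSingletonClass_gaussianReal one_ne_zero
  have ht : 0 < 1 - t ^ 2 := by nlinarith
  have hint : Integrable (fun w : Fin k → ℝ =>
      gaussTail (t / √(1 - t ^ 2) * √(∑ i, w i ^ 2)))
      (Measure.pi fun _ : Fin k => gaussianReal 0 1) := by
    refine Integrable.of_bound (C := 1)
      (antitone_gaussTail.measurable.comp (by fun_prop)).aestronglyMeasurable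
      (ae_of_all _ fun w => ?_)
    rw [Real.norm_of_nonneg (gaussTail_nonneg _)]
    exact gaussTail_le_one _
  have hm := measurableSet_corrBody k t
  have hc : ((gaussianReal 0 1).prod (Measure.pi fun _ : Fin k => gaussianReal 0 1))
      (corrBody k t)ᶜ = ENNReal.ofReal (radialTail k (t / √(1 - t ^ 2))) := by
    rw [Measure.prod_apply_symm hm.compl, radialTail,
      ofReal_integral_eq_lintegral_ofReal hint (ae_of_all _ fun _ => gaussTail_nonneg _)]
    refine lintegral_congr_ae ?_
    -- Almost surely `w ≠ 0`, so the quotient is a genuine one and its denominator can be cleared.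
    have h0 : ∀ᵐ w ∂(Measure.pi fun _ : Fin k => gaussianReal 0 1), w ⟨0, hk⟩ ≠ 0 := by
      have := Measure.pi_hyperplane (fun _ : Fin k => gaussianReal 0 1) ⟨0, hk⟩ 0
      rw [ae_iff]
      simpa using this
    filter_upwards [h0] with w hw
    rw [gaussTail, ofReal_measureReal]
    congr 1
    ext z
    have hS : 0 < ∑ i, w i ^ 2 :=
      Finset.sum_pos' (fun i _ => sq_nonneg _) ⟨_, Finset.mem_univ _, by positivity⟩
    simp only [corrBody, Set.mem_preimage, Set.mem_compl_iff, Set.mem_ofPred_eq, not_lt]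
    generalize ∑ i, w i ^ 2 = S at hS ⊢
    have hzS : 0 < z ^ 2 + S := by positivity
    -- After squaring, both conditions read t²S ≤ (1 - t²)z².
    rw [abs_div, abs_of_nonneg (Real.sqrt_nonneg (z ^ 2 + S)), le_div_iff₀ (Real.sqrt_pos.2 hzS),
      ← sq_le_sq₀ (by positivity) (abs_nonneg z), mul_pow, Real.sq_sqrt hzS.le,
      ← sq_le_sq₀ (a := t / √(1 - t ^ 2) * √S) (by positivity) (abs_nonneg z), mul_pow, div_pow,
      Real.sq_sqrt hS.le, Real.sq_sqrt ht.le, sq_abs, div_mul_eq_mul_div, div_le_iff₀ ht]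
    constructor <;> intro h <;> linarith
  have h1 := probReal_compl_eq_one_sub
    (μ := (gaussianReal 0 1).prod (Measure.pi fun _ : Fin k => gaussianReal 0 1)) hm
  have h2 : 0 ≤ radialTail k (t / √(1 - t ^ 2)) := integral_nonneg fun _ => gaussTail_nonneg _
  rw [measureReal_def, hc, ENNReal.toReal_ofReal h2] at h1
  linarith

/-! ### Exact law of the maximum -/

theorem IsGaussianNull.hasLaw {Ω : Type*} [MeasurableSpace Ω] {n p : ℕ}
    {X : Fin n → Fin p → Ω → ℝ} {ε : Fin n → Ω → ℝ} {P : Measure Ω}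
    (h : IsGaussianNull X ε P) :
    HasLaw (fun ω => ((fun j i => X i j ω, fun i => ε i ω) : (Fin p → Fin n → ℝ) × (Fin n → ℝ)))
      ((Measure.pi fun _ : Fin p => Measure.pi fun _ : Fin n => gaussianReal 0 1).prod
        (Measure.pi fun _ : Fin n => gaussianReal 0 1)) P := by
  have hinj : Function.Injective
      (Sum.map Prod.swap id : (Fin p × Fin n) ⊕ Fin n → (Fin n × Fin p) ⊕ Fin n) :=
    Sum.map_injective.2 ⟨Prod.swap_injective, Function.injective_id⟩
  have h1 := (h.indep.precomp hinj).hasLaw_pi (μ := fun _ => gaussianReal 0 1) (by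
    rintro (⟨j, i⟩ | i)
    · exact h.hasLaw_design i j
    · exact h.hasLaw_noise i)
  have h2 := measurePreserving_sumPiEquivProdPi
    (fun _ : (Fin p × Fin n) ⊕ Fin n => gaussianReal 0 1)
  have h3 : MeasurePreserving (MeasurableEquiv.curry (Fin p) (Fin n) ℝ)
      (Measure.pi fun _ => gaussianReal 0 1)
      (Measure.pi fun _ : Fin p => Measure.pi fun _ : Fin n => gaussianReal 0 1) := by
    refine ⟨MeasurableEquiv.measurable _, ?_⟩
    have := Measure.infinitePi_map_curry (fun (_ : Fin p) (_ : Fin n) => gaussianReal 0 1)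
    simpa only [Measure.infinitePi_eq_pi] using this
  exact ((h3.prod (MeasurePreserving.id _)).comp h2).comp_hasLaw h1

theorem measurable_maxAbsCorr {n p : ℕ} :
    Measurable fun q : (Fin p → Fin n → ℝ) × (Fin n → ℝ) =>
      maxAbsCorr (fun i j => q.1 j i) q.2 := by
  unfold maxAbsCorr
  refine Measurable.iSup fun j => Measurable.abs ?_
  have hg : Measurable fun q : (Fin p → Fin n → ℝ) × (Fin n → ℝ) => (q.1 j, q.2) := by fun_prop
  exact measurable_sampleCorr.comp hg

theorem IsGaussianNull.aemeasurable_spuriousCorr {Ω : Type*} [MeasurableSpace Ω] {n p : ℕ}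
    {X : Fin n → Fin p → Ω → ℝ} {ε : Fin n → Ω → ℝ} {P : Measure Ω}
    (h : IsGaussianNull X ε P) : AEMeasurable (spuriousCorr X ε) P := by
  have := (measurable_maxAbsCorr (n := n) (p := p)).comp_aemeasurable h.hasLaw.aemeasurable
  exact this

theorem maxAbsCorr_lt_iff {n p : ℕ} (hp : 0 < p) (x : Fin n → Fin p → ℝ) (e : Fin n → ℝ) (t : ℝ) :
    maxAbsCorr x e < t ↔ ∀ j, |sampleCorr (fun i => x i j) e| < t := by
  have : Nonempty (Fin p) := ⟨⟨0, hp⟩⟩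
  constructor
  · exact fun h j => (le_ciSup (Set.finite_range _).bddAbove j).trans_lt h
  · intro h
    obtain ⟨j, hj⟩ := exists_eq_ciSup_of_finite (f := fun j => |sampleCorr (fun i => x i j) e|)
    rw [maxAbsCorr, ← hj]
    exact h j

/-- The exact distribution function of the maximum absolute sample correlation. -/
theorem IsGaussianNull.measureReal_spuriousCorr_lt {Ω : Type*} [MeasurableSpace Ω] {k p : ℕ}
    {X : Fin (k + 2) → Fin p → Ω → ℝ} {ε : Fin (k + 2) → Ω → ℝ} {P : Measure Ω}
    (h : IsGaussianNull X ε P) (hk : 1 ≤ k) (hp : 0 < p) {t : ℝ} (ht0 : 0 < t) (ht1 : t < 1) :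
    P.real {ω | spuriousCorr X ε ω < t} = (1 - radialTail k (t / √(1 - t ^ 2))) ^ p := by
  rw [← prod_gaussianReal_corrBody hk ht0 ht1, measureReal_def, measureReal_def,
    ← ENNReal.toReal_pow]
  congr 1
  have hm : MeasurableSet {q : (Fin p → Fin (k + 2) → ℝ) × (Fin (k + 2) → ℝ) |
      maxAbsCorr (fun i j => q.1 j i) q.2 < t} :=
    measurableSet_lt measurable_maxAbsCorr measurable_const
  refine (h.hasLaw.measure_eq hm).trans ?_
  rw [Measure.prod_apply_symm hm]
  refine Eq.trans (lintegral_congr_ae (g := fun _ => (((gaussianReal 0 1).prod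
    (Measure.pi fun _ : Fin k => gaussianReal 0 1)) (corrBody k t)) ^ p) ?_) ?_
  -- For fixed `e` the event is a product over columns, and all factors have the same probability,
  -- independent of `e`.
  · filter_upwards [pi_gaussianReal_sum_sub_sampleMean_ne] with e he
    have hset : ((fun Y : Fin p → Fin (k + 2) → ℝ => (Y, e)) ⁻¹'
        {q | maxAbsCorr (fun i j => q.1 j i) q.2 < t}) =
        Set.univ.pi fun _ => {x | |sampleCorr x e| < t} := by
      ext Y
      simp only [Set.mem_preimage, Set.mem_ofPred_eq, maxAbsCorr_lt_iff hp, Set.mem_univ_pi]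
    rw [hset, Measure.pi_pi]
    simp [pi_gaussianReal_abs_sampleCorr_lt e he]
  · simp

/-! ### Asymptotics of the Gamma ratio -/

/-- Log-convexity of Γ at the midpoint of a and a + 1. -/
theorem Gamma_add_half_le {a : ℝ} (ha : 0 < a) :
    Real.Gamma (a + 1 / 2) ≤ √a * Real.Gamma a := by
  have h := Real.Gamma_mul_add_mul_le_rpow_Gamma_mul_rpow_Gamma ha (by linarith : 0 < a + 1)
    (by norm_num : (0 : ℝ) < 1 / 2) (by norm_num : (0 : ℝ) < 1 / 2) (by norm_num)
  have hG := Real.Gamma_pos_of_pos ha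
  rw [Real.Gamma_add_one ha.ne', Real.mul_rpow ha.le hG.le, ← Real.sqrt_eq_rpow,
    ← Real.sqrt_eq_rpow] at h
  calc _ = Real.Gamma (1 / 2 * a + 1 / 2 * (a + 1)) := by ring_nf
    _ ≤ _ := h
    _ = √a * (√(Real.Gamma a) * √(Real.Gamma a)) := by ring
    _ = _ := by rw [Real.mul_self_sqrt hG.le]

/-- The half-step bound at a gives the lower bound 1; at a - 1/2, combined with the functional
equation, it gives the upper bound √(a / (a - 1/2)). -/
theorem tendsto_Gamma_ratio :
    Tendsto (fun a : ℝ => √a * (Real.Gamma a / Real.Gamma (a + 1 / 2))) atTop (𝓝 1) := by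
  have h1 : Tendsto (fun a : ℝ => √(1 + (1 / 2) / (a - 1 / 2))) atTop (𝓝 1) := by
    have : Tendsto (fun a : ℝ => (1 / 2) / (a - 1 / 2)) atTop (𝓝 0) :=
      (tendsto_atTop_add_const_right _ (-(1 / 2) : ℝ) tendsto_id).const_div_atTop _
    simpa using (this.const_add 1).sqrt
  refine tendsto_of_tendsto_of_tendsto_of_le_of_le' tendsto_const_nhds h1 ?_ ?_
  · filter_upwards [eventually_gt_atTop 0] with a ha
    have hG := Real.Gamma_pos_of_pos (by linarith : 0 < a + 1 / 2)
    rw [← mul_div_assoc, one_le_div hG]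
    exact Gamma_add_half_le ha
  · filter_upwards [eventually_gt_atTop 1] with a ha
    have hG := Real.Gamma_pos_of_pos (by linarith : 0 < a + 1 / 2)
    have ha' : 0 < a - 1 / 2 := by linarith
    have h2 := Gamma_add_half_le ha'
    have h3 := Real.Gamma_add_one ha'.ne'
    rw [sub_add_cancel] at h2
    rw [show a - 1 / 2 + 1 = a + 1 / 2 by ring] at h3
    have h4 : 1 + 1 / 2 / (a - 1 / 2) = a / (a - 1 / 2) := by
      rw [eq_div_iff ha'.ne', add_mul, div_mul_cancel₀ _ ha'.ne']
      ring
    rw [← mul_div_assoc, div_le_iff₀ hG, h3, h4, Real.sqrt_div (by linarith)]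
    generalize a - 1 / 2 = b at *
    calc √a * Real.Gamma a ≤ √a * (√b * Real.Gamma b) := by gcongr
      _ = _ := by
        have : √b ≠ 0 := (Real.sqrt_pos.2 ha').ne'
        field_simp
        rw [Real.sq_sqrt ha'.le]

/-! ### The Gumbel threshold -/

/-- The threshold `a - log (√(2π) a) / a + x / a`, which is `d_q + x / a` for `a = √(2 log q)`. -/
noncomputable def gumbelThreshold (x a : ℝ) : ℝ := a - Real.log (√(2 * Real.pi) * a) / a + x / a

theorem gumbelCentering_add_div (x q : ℝ) :
    gumbelCentering q + x / √(2 * Real.log q) = gumbelThreshold x √(2 * Real.log q) := by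
  rw [gumbelCentering, gumbelThreshold, ← Real.sqrt_mul (by positivity)]
  ring_nf

theorem tendsto_log_mul_div_atTop :
    Tendsto (fun a : ℝ => Real.log (√(2 * Real.pi) * a) / a) atTop (𝓝 0) := by
  have h1 : Tendsto (fun a : ℝ => Real.log a / a) atTop (𝓝 0) :=
    Real.isLittleO_log_id_atTop.tendsto_div_nhds_zero
  have h2 : Tendsto (fun a : ℝ => Real.log √(2 * Real.pi) / a) atTop (𝓝 0) :=
    tendsto_id.const_div_atTop _
  have h3 := h2.add h1
  rw [add_zero] at h3
  refine h3.congr' ?_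
  filter_upwards [eventually_gt_atTop 0] with a ha
  rw [Real.log_mul (by positivity) ha.ne', add_div]

theorem tendsto_gumbelThreshold_div (x : ℝ) :
    Tendsto (fun a => gumbelThreshold x a / a) atTop (𝓝 1) := by
  have h1 := tendsto_log_mul_div_atTop.mul (tendsto_inv_atTop_zero (𝕜 := ℝ))
  have h2 := (tendsto_id.const_div_atTop (α := ℝ) x).mul (tendsto_inv_atTop_zero (𝕜 := ℝ))
  have h3 := (h1.const_sub 1).add h2
  simp only [mul_zero, sub_zero, add_zero] at h3
  refine h3.congr' ?_
  filter_upwards [eventually_gt_atTop 0] with a ha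
  rw [gumbelThreshold]
  simp only [id]
  field_simp

theorem tendsto_gumbelThreshold_atTop (x : ℝ) :
    Tendsto (gumbelThreshold x) atTop atTop := by
  refine ((tendsto_gumbelThreshold_div x).pos_mul_atTop one_pos tendsto_id).congr' ?_
  filter_upwards [eventually_gt_atTop 0] with a ha
  simp only [id]
  field_simp

/-- The normal tail estimate at the threshold, in terms of the number `exp (a² / 2)`. -/
theorem tendsto_exp_gumbelThreshold (x : ℝ) :
    Tendsto (fun a => Real.exp (a ^ 2 / 2 - gumbelThreshold x a ^ 2 / 2) /
      (√(2 * Real.pi) * gumbelThreshold x a)) atTop (𝓝 (Real.exp (-x))) := by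
  have h1 : Tendsto (fun a : ℝ => -((x / a - Real.log (√(2 * Real.pi) * a) / a) ^ 2 / 2)) atTop
      (𝓝 0) := by
    have := (((tendsto_id.const_div_atTop (α := ℝ) x).sub tendsto_log_mul_div_atTop).pow 2
      |>.div_const 2).neg
    simpa using this
  have h2 := ((Real.continuous_exp.tendsto 0).comp h1).const_mul (Real.exp (-x))
  have h3 := h2.mul ((tendsto_gumbelThreshold_div x).inv₀ one_ne_zero)
  simp only [Real.exp_zero, mul_one, inv_one] at h3
  refine h3.congr' ?_
  filter_upwards [eventually_gt_atTop 0,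
    (tendsto_gumbelThreshold_atTop x).eventually_gt_atTop 0] with a ha hs
  have hpi : 0 < √(2 * Real.pi) := by positivity
  -- Writing the threshold as a + r, the difference is -ar - r²/2, and -ar is exactly log(√(2π)a) -
  -- x.
  have key : a ^ 2 / 2 - gumbelThreshold x a ^ 2 / 2 = Real.log (√(2 * Real.pi) * a) + -x +
      -((x / a - Real.log (√(2 * Real.pi) * a) / a) ^ 2 / 2) := by
    rw [gumbelThreshold]
    field_simp
    ring
  rw [key, Real.exp_add, Real.exp_add, Real.exp_log (by positivity)]
  simp only [Function.comp]
  field_simp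

/-! ### Tail of a sample correlation at the threshold -/

/-- The leading term of the probability that a sample correlation of `n` observations exceeds
`s / √n`. -/
noncomputable def corrTailMain (n : ℕ) (s : ℝ) : ℝ :=
  (√Real.pi)⁻¹ * (√n / s) * (1 - s ^ 2 / n) ^ (((n : ℝ) - 2) / 2) *
    (Real.Gamma (((n : ℝ) - 3) / 2) / Real.Gamma (((n : ℝ) - 3) / 2 + 1 / 2))

/-- The probability that a sample correlation of `n` observations is at least `s / √n`. -/
noncomputable def corrTail (n : ℕ) (s : ℝ) : ℝ :=
  radialTail (n - 2) (s / √n / √(1 - (s / √n) ^ 2))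

theorem corrTail_bounds {n : ℕ} (hn : 6 ≤ n) {s : ℝ} (hs : 0 < s) (hsn : s ^ 2 < n) :
    corrTailMain n s * (1 - n / (s ^ 2 * (n - 5))) ≤ corrTail n s ∧
      corrTail n s ≤ corrTailMain n s := by
  -- The radial vector has dimension n - 2 = m + 4.
  obtain ⟨m, rfl⟩ : ∃ m, n = m + 6 := ⟨n - 6, by omega⟩
  have hm : (0 : ℝ) ≤ m := m.cast_nonneg
  set N : ℝ := ((m + 6 : ℕ) : ℝ) with hN
  have hN' : N = m + 6 := by rw [hN]; push_cast; ring
  have hN0 : 0 < N := by rw [hN']; positivity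
  have hu : (s / √N) ^ 2 = s ^ 2 / N := by rw [div_pow, Real.sq_sqrt hN0.le]
  have hu1 : 0 < 1 - s ^ 2 / N := by
    rw [sub_pos, div_lt_one hN0]
    exact hsn
  have hu2 : N - s ^ 2 ≠ 0 := (sub_pos.2 hsn).ne'
  set c : ℝ := s / √N / √(1 - (s / √N) ^ 2) with hc
  have hc0 : 0 < c := by rw [hc, hu]; positivity
  have hc2 : 1 + c ^ 2 = (1 - s ^ 2 / N)⁻¹ := by
    rw [hc, div_pow, hu, Real.sq_sqrt hu1.le]
    field_simp
    ring
  have hmain : radialTailMain m c = corrTailMain (m + 6) s := by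
    rw [radialTailMain, corrTailMain, hc2, ← hN, Real.inv_rpow hu1.le, ← Real.rpow_neg hu1.le,
      show -(-((m : ℝ) + 3) / 2) = ((m : ℝ) + 3) / 2 by ring,
      -- The extra exponent 1/2 comes from c⁻¹, which contains √(1 - s²/n).
      show (N - 2) / 2 = ((m : ℝ) + 3) / 2 + 1 / 2 by rw [hN']; ring,
      Real.rpow_add hu1, ← Real.sqrt_eq_rpow,
      show (N - 3) / 2 = ((m : ℝ) + 3) / 2 by rw [hN']; ring,
      show ((m : ℝ) + 3) / 2 + 1 / 2 = ((m : ℝ) + 4) / 2 by ring, hc, hu]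
    have : √(1 - s ^ 2 / N) ≠ 0 := by positivity
    have : √N ≠ 0 := by positivity
    generalize √(1 - s ^ 2 / N) = R at *
    generalize √N = M at *
    field_simp
  have hcorr : (1 + c ^ 2) / (c ^ 2 * (m + 1)) = N / (s ^ 2 * (N - 5)) := by
    have : N - 5 = m + 1 := by rw [hN']; ring
    rw [this, hc2, hc, div_pow, hu, Real.sq_sqrt hu1.le]
    field_simp
  have e : corrTail (m + 6) s = radialTail (m + 4) c := rfl
  rw [e, ← hmain, ← hcorr]
  exact ⟨le_radialTail m hc0, radialTail_le m hc0⟩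

/-- Since log(1 - u) = -u + O(u²), the logarithm of the product is O(nu²) + u. With u = s²/n the
condition is s⁴/n → 0, and this is where the growth condition on p is needed. -/
theorem tendsto_one_sub_rpow_mul_exp {u : ℕ → ℝ} (hu : Tendsto u atTop (𝓝 0))
    (hu2 : Tendsto (fun n => n * u n ^ 2) atTop (𝓝 0)) :
    Tendsto (fun n : ℕ => (1 - u n) ^ (((n : ℝ) - 2) / 2) * Real.exp (n * u n / 2)) atTop
      (𝓝 1) := by
  have h0 : Tendsto (fun n : ℕ => ((n : ℝ) - 2) / 2 * (u n + Real.log (1 - u n)) + u n) atTop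
      (𝓝 0) := by
    have h1 : Tendsto (fun n : ℕ => ((n : ℝ) - 2) / 2 * (u n + Real.log (1 - u n))) atTop
        (𝓝 0) := by
      refine squeeze_zero_norm' ?_ hu2
      have hs := (tendsto_order.1 hu.norm).2 (1 / 2) (by norm_num)
      filter_upwards [hs, eventually_ge_atTop 2] with n hn h2
      have h2' : (2 : ℝ) ≤ n := by exact_mod_cast h2
      rw [Real.norm_eq_abs] at hn
      have h3 := Real.abs_log_sub_add_sum_range_le (x := u n) (by linarith) 1
      simp only [Finset.sum_range_one, zero_add, pow_one, Nat.cast_zero, div_one, one_add_one_eq_two,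
        sq_abs] at h3
      -- The Taylor remainder is at most u²/(1 - |u|), and |u| < 1/2.
      have h4 : |u n + Real.log (1 - u n)| ≤ 2 * u n ^ 2 := by
        refine h3.trans ?_
        rw [div_le_iff₀ (by linarith)]
        nlinarith [sq_nonneg (u n)]
      rw [norm_mul, Real.norm_eq_abs, Real.norm_eq_abs, abs_of_nonneg (by linarith)]
      calc ((n : ℝ) - 2) / 2 * |u n + Real.log (1 - u n)| ≤ n / 2 * (2 * u n ^ 2) := by
            gcongr
            linarith
        _ = _ := by ring
    simpa using h1.add hu
  have h1 := (Real.continuous_exp.tendsto 0).comp h0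
  rw [Real.exp_zero] at h1
  refine h1.congr' ?_
  filter_upwards [(tendsto_order.1 hu).2 1 one_pos] with n hn
  rw [Real.rpow_def_of_pos (by linarith), ← Real.exp_add]
  simp only [Function.comp]
  ring_nf

/-- The expected number of exceedances of the Gumbel threshold converges to `exp (-x)`. -/
theorem tendsto_mul_corrTail {p : ℕ → ℕ} {a : ℕ → ℝ} (ha : Tendsto a atTop atTop)
    (hp : ∀ᶠ n in atTop, Real.exp (a n ^ 2 / 2) = 2 * p n)
    (han : Tendsto (fun n : ℕ => a n ^ 2 / √n) atTop (𝓝 0)) (x : ℝ) :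
    Tendsto (fun n : ℕ => gumbelThreshold x (a n) ^ 2 / n) atTop (𝓝 0) ∧
    Tendsto (fun n => p n * corrTail n (gumbelThreshold x (a n))) atTop (𝓝 (Real.exp (-x))) := by
  set s : ℕ → ℝ := fun n => gumbelThreshold x (a n) with hs
  have hsa : Tendsto (fun n => s n / a n) atTop (𝓝 1) := (tendsto_gumbelThreshold_div x).comp ha
  have hst : Tendsto s atTop atTop := (tendsto_gumbelThreshold_atTop x).comp ha
  have hsqrt : Tendsto (fun n : ℕ => (√(n : ℝ))⁻¹) atTop (𝓝 0) :=
    (Real.tendsto_sqrt_atTop.comp tendsto_natCast_atTop_atTop).inv_tendsto_atTop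
  have hv : Tendsto (fun n : ℕ => s n ^ 2 / √n) atTop (𝓝 0) := by
    have := (hsa.pow 2).mul han
    rw [mul_zero] at this
    refine this.congr' ?_
    filter_upwards [ha.eventually_gt_atTop 0] with n hn
    field_simp
  have hu : Tendsto (fun n : ℕ => s n ^ 2 / n) atTop (𝓝 0) := by
    have := hv.mul hsqrt
    rw [mul_zero] at this
    refine this.congr fun n => ?_
    rw [← div_eq_mul_inv, div_div, Real.mul_self_sqrt n.cast_nonneg]
  refine ⟨hu, ?_⟩
  have hu2 : Tendsto (fun n : ℕ => n * (s n ^ 2 / n) ^ 2) atTop (𝓝 0) := by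
    have := hv.pow 2
    rw [zero_pow two_ne_zero] at this
    refine this.congr' ?_
    filter_upwards [eventually_gt_atTop 0] with n hn
    have : (0 : ℝ) < n := by exact_mod_cast hn
    rw [div_pow, Real.sq_sqrt this.le]
    field_simp
  have hA := (tendsto_exp_gumbelThreshold x).comp ha
  have hB := tendsto_one_sub_rpow_mul_exp hu hu2
  have hlin : Tendsto (fun n : ℕ => ((n : ℝ) - 3) / 2) atTop atTop :=
    (tendsto_atTop_add_const_right _ (-3 : ℝ) tendsto_natCast_atTop_atTop).atTop_div_const two_pos
  -- Compensates for the Gamma ratio being normalized by √((n - 3)/2) where √(n/2) is wanted.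
  have hfrac : Tendsto (fun n : ℕ => (3 / 2) / (((n : ℝ) - 3) / 2)) atTop (𝓝 0) :=
    hlin.const_div_atTop _
  have hC := (tendsto_Gamma_ratio.comp hlin).mul ((hfrac.const_add 1).sqrt)
  have hABC := (hA.mul hB).mul hC
  simp only [add_zero, Real.sqrt_one, mul_one] at hABC
  have hmain : Tendsto (fun n => p n * corrTailMain n (s n)) atTop (𝓝 (Real.exp (-x))) := by
    refine hABC.congr' ?_
    filter_upwards [hp, eventually_ge_atTop 6, hst.eventually_gt_atTop 0] with n hpn hn hsn
    have hn' : (6 : ℝ) ≤ n := by exact_mod_cast hn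
    have e1 : √(((n : ℝ) - 3) / 2) * √(1 + 3 / 2 / (((n : ℝ) - 3) / 2)) = √n / √2 := by
      rw [← Real.sqrt_mul (by linarith), ← Real.sqrt_div (by linarith)]
      congr 1
      have : (n : ℝ) - 3 ≠ 0 := by linarith
      field_simp
      ring
    have e2 : Real.exp (a n ^ 2 / 2 - s n ^ 2 / 2) * Real.exp (n * (s n ^ 2 / n) / 2) =
        2 * p n := by
      rw [← hpn, ← Real.exp_add]
      congr 1
      field_simp
      ring
    have e3 : √2 * √2 = (2 : ℝ) := Real.mul_self_sqrt (by norm_num)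
    have h2 : √(2 : ℝ) ≠ 0 := by positivity
    simp only [Function.comp, corrTailMain]
    calc _ = (Real.exp (a n ^ 2 / 2 - s n ^ 2 / 2) * Real.exp (n * (s n ^ 2 / n) / 2)) *
          (√(((n : ℝ) - 3) / 2) * √(1 + 3 / 2 / (((n : ℝ) - 3) / 2))) /
          (√(2 * Real.pi) * s n) * (1 - s n ^ 2 / n) ^ (((n : ℝ) - 2) / 2) *
          (Real.Gamma (((n : ℝ) - 3) / 2) / Real.Gamma (((n : ℝ) - 3) / 2 + 1 / 2)) := by ring
      _ = (2 / (√2 * √2)) * (p n * ((√Real.pi)⁻¹ * (√n / s n) *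
          (1 - s n ^ 2 / n) ^ (((n : ℝ) - 2) / 2) *
          (Real.Gamma (((n : ℝ) - 3) / 2) / Real.Gamma (((n : ℝ) - 3) / 2 + 1 / 2)))) := by
        rw [e1, e2, Real.sqrt_mul (by norm_num)]
        have : √Real.pi ≠ 0 := by positivity
        field_simp
      _ = _ := by rw [e3, div_self two_ne_zero, one_mul]
  -- The relative loss is s⁻²(1 + 5/(n - 5)), which vanishes because the threshold diverges.
  have hcorr : Tendsto (fun n : ℕ => 1 - n / (s n ^ 2 * (n - 5))) atTop (𝓝 1) := by
    have h1 : Tendsto (fun n : ℕ => (s n ^ 2)⁻¹) atTop (𝓝 0) :=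
      ((tendsto_pow_atTop two_ne_zero).comp hst).inv_tendsto_atTop
    have h2 : Tendsto (fun n : ℕ => 1 + 5 / ((n : ℝ) - 5)) atTop (𝓝 (1 + 0)) :=
      ((tendsto_atTop_add_const_right _ (-5 : ℝ)
        tendsto_natCast_atTop_atTop).const_div_atTop _).const_add 1
    have h3 := (h1.mul h2).const_sub 1
    rw [zero_mul, sub_zero] at h3
    refine h3.congr' ?_
    filter_upwards [eventually_ge_atTop 6] with n hn
    have hn' : (6 : ℝ) ≤ n := by exact_mod_cast hn
    have : (n : ℝ) - 5 ≠ 0 := by linarith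
    field_simp
    ring
  have hlow := hmain.mul hcorr
  rw [mul_one] at hlow
  have hbd : ∀ᶠ n : ℕ in atTop, corrTailMain n (s n) * (1 - n / (s n ^ 2 * (n - 5))) ≤
      corrTail n (s n) ∧ corrTail n (s n) ≤ corrTailMain n (s n) := by
    filter_upwards [eventually_ge_atTop 6, hst.eventually_gt_atTop 0,
      (tendsto_order.1 hu).2 1 one_pos] with n hn hsn h1
    have hn' : (0 : ℝ) < n := by exact_mod_cast (by omega : 0 < n)
    exact corrTail_bounds hn hsn ((div_lt_one hn').1 h1)
  refine tendsto_of_tendsto_of_tendsto_of_le_of_le' hlow hmain ?_ ?_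
  · filter_upwards [hbd] with n hn
    rw [mul_assoc]
    exact mul_le_mul_of_nonneg_left hn.1 (Nat.cast_nonneg _)
  · filter_upwards [hbd] with n hn
    exact mul_le_mul_of_nonneg_left hn.2 (Nat.cast_nonneg _)

/-! ### From exceedance counts to the maximum -/

/-- The Poisson approximation `(1 - F)^p ≈ exp (-p F)`. -/
theorem tendsto_one_sub_pow {p : ℕ → ℕ} (hp : Tendsto p atTop atTop) {F : ℕ → ℝ} {l : ℝ}
    (hF : Tendsto (fun n => p n * F n) atTop (𝓝 l)) :
    Tendsto (fun n => (1 - F n) ^ p n) atTop (𝓝 (Real.exp (-l))) := by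
  have hp' : Tendsto (fun n => (p n : ℝ)) atTop atTop := tendsto_natCast_atTop_atTop.comp hp
  have hF0 : Tendsto F atTop (𝓝 0) := by
    have := hF.mul hp'.inv_tendsto_atTop
    rw [mul_zero] at this
    refine this.congr' ?_
    filter_upwards [hp'.eventually_gt_atTop 0] with n hn
    simp only [Pi.inv_apply]
    field_simp
  have hup : Tendsto (fun n => Real.exp (-(p n * F n))) atTop (𝓝 (Real.exp (-l))) :=
    (Real.continuous_exp.tendsto _).comp hF.neg
  have hlo : Tendsto (fun n => Real.exp (-(p n * F n / (1 - F n)))) atTop (𝓝 (Real.exp (-l))) := by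
    have := (hF.div (hF0.const_sub 1) (by norm_num)).neg
    rw [sub_zero, div_one] at this
    exact (Real.continuous_exp.tendsto _).comp this
  have hlt := (tendsto_order.1 hF0).2 1 one_pos
  refine tendsto_of_tendsto_of_tendsto_of_le_of_le' hlo hup ?_ ?_
  · filter_upwards [hlt] with n hn
    have h1 : 0 < 1 - F n := by linarith
    -- Invert 1/(1 - F) = 1 + F/(1 - F) ≤ exp(F/(1 - F)).
    have h2 : Real.exp (-(F n / (1 - F n))) ≤ 1 - F n := by
      rw [Real.exp_neg]
      refine inv_le_of_inv_le₀ h1 ?_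
      refine le_trans (le_of_eq ?_) (Real.add_one_le_exp _)
      field_simp
      ring
    calc _ = Real.exp (-(F n / (1 - F n))) ^ p n := by
          rw [← Real.exp_nat_mul]
          ring_nf
      _ ≤ _ := by gcongr
  · filter_upwards [hlt] with n hn
    have h1 : 0 ≤ 1 - F n := by linarith
    calc (1 - F n) ^ p n ≤ Real.exp (-F n) ^ p n := by
          gcongr
          exact Real.one_sub_le_exp_neg _
      _ = _ := by
          rw [← Real.exp_nat_mul]
          ring_nf

theorem IsGaussianNull.measureReal_spuriousCorr_lt_div_sqrt {Ω : Type*} [MeasurableSpace Ω]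
    {n p : ℕ} {X : Fin n → Fin p → Ω → ℝ} {ε : Fin n → Ω → ℝ} {P : Measure Ω}
    (h : IsGaussianNull X ε P) (hn : 3 ≤ n) (hp : 0 < p) {s : ℝ} (hs : 0 < s) (hsn : s ^ 2 < n) :
    P.real {ω | spuriousCorr X ε ω < s / √n} = (1 - corrTail n s) ^ p := by
  obtain ⟨k, rfl⟩ : ∃ k, n = k + 2 := ⟨n - 2, by omega⟩
  have hn0 : (0 : ℝ) < ((k + 2 : ℕ) : ℝ) := by positivity
  refine h.measureReal_spuriousCorr_lt (by omega) hp (by positivity) ?_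
  rw [div_lt_one (by positivity)]
  exact Real.lt_sqrt_of_sq_lt hsn

theorem tendsto_sqrt_log_two_mul {p : ℕ → ℕ} (hp : Tendsto p atTop atTop) :
    Tendsto (fun n => √(2 * Real.log (2 * (p n : ℝ)))) atTop atTop := by
  refine Real.tendsto_sqrt_atTop.comp (Tendsto.const_mul_atTop two_pos ?_)
  exact Real.tendsto_log_atTop.comp
    (Tendsto.const_mul_atTop two_pos (tendsto_natCast_atTop_atTop.comp hp))

/-- The additive log 2 is negligible against log(2p), so the doubling due to absolute values is
invisible at first order. -/
theorem tendsto_sqrt_log_div_sqrt_log_two_mul {p : ℕ → ℕ} (hp : Tendsto p atTop atTop) :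
    Tendsto (fun n => √(2 * Real.log (p n : ℝ)) / √(2 * Real.log (2 * (p n : ℝ)))) atTop
      (𝓝 1) := by
  have hL : Tendsto (fun n => Real.log (2 * (p n : ℝ))) atTop atTop :=
    Real.tendsto_log_atTop.comp
      (Tendsto.const_mul_atTop two_pos (tendsto_natCast_atTop_atTop.comp hp))
  have h1 := ((hL.const_div_atTop (Real.log 2)).const_sub 1).sqrt
  rw [sub_zero, Real.sqrt_one] at h1
  refine h1.congr' ?_
  filter_upwards [hL.eventually_gt_atTop 0, hp.eventually_gt_atTop 0] with n hn hpn
  have hpn' : (0 : ℝ) < p n := by exact_mod_cast hpn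
  rw [← Real.sqrt_div' _ (by positivity)]
  congr 1
  have : Real.log (2 * (p n : ℝ)) = Real.log 2 + Real.log (p n) :=
    Real.log_mul two_ne_zero hpn'.ne'
  rw [mul_div_mul_left _ _ two_ne_zero, one_sub_div hn.ne']
  congr 1
  linarith

theorem tendsto_log_two_mul_div_sqrt {p : ℕ → ℕ} (hp : Tendsto p atTop atTop)
    (hlog : (fun n => Real.log (p n)) =o[atTop] (fun n : ℕ => (n : ℝ) ^ (1 / 2 : ℝ))) :
    Tendsto (fun n : ℕ => √(2 * Real.log (2 * (p n : ℝ))) ^ 2 / √n) atTop (𝓝 0) := by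
  have h1 : Tendsto (fun n : ℕ => Real.log (p n) / √n) atTop (𝓝 0) := by
    have := hlog.tendsto_div_nhds_zero
    simpa only [← Real.sqrt_eq_rpow] using this
  have h2 : Tendsto (fun n : ℕ => Real.log 2 / √n) atTop (𝓝 0) :=
    (Real.tendsto_sqrt_atTop.comp tendsto_natCast_atTop_atTop).const_div_atTop _
  have h3 := (h2.add h1).const_mul 2
  rw [add_zero, mul_zero] at h3
  refine h3.congr' ?_
  filter_upwards [hp.eventually_gt_atTop 0] with n hn
  have hn' : (1 : ℝ) ≤ p n := by exact_mod_cast hn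
  have hl : 0 ≤ Real.log (2 * (p n : ℝ)) := Real.log_nonneg (by linarith)
  rw [Real.sq_sqrt (by positivity), Real.log_mul two_ne_zero (by linarith)]
  ring

/-! ### The two limit theorems -/

section

variable {Ω : ℕ → Type*} [∀ n, MeasurableSpace (Ω n)] {P : ∀ n, Measure (Ω n)} {p : ℕ → ℕ}
  {X : ∀ n, Fin n → Fin (p n) → Ω n → ℝ} {ε : ∀ n, Fin n → Ω n → ℝ}

/-- The normalized maximum sample correlation converges in distribution to the Gumbel law. -/
theorem tendsto_measureReal_gumbel (hp : Tendsto p atTop atTop)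
    (hlog : (fun n => Real.log (p n)) =o[atTop] (fun n : ℕ => (n : ℝ) ^ (1 / 2 : ℝ)))
    (hnull : ∀ n, IsGaussianNull (X n) (ε n) (P n)) (x : ℝ) :
    Tendsto (fun n => (P n).real {ω |
      √(2 * Real.log (2 * (p n : ℝ))) *
        (√n * spuriousCorr (X n) (ε n) ω - gumbelCentering (2 * (p n : ℝ))) < x})
      atTop (𝓝 (Real.exp (-Real.exp (-x)))) := by
  have ha := tendsto_sqrt_log_two_mul hp
  have hexp : ∀ᶠ n in atTop, Real.exp (√(2 * Real.log (2 * (p n : ℝ))) ^ 2 / 2) = 2 * p n := by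
    filter_upwards [hp.eventually_gt_atTop 0] with n hn
    have hn' : (1 : ℝ) ≤ p n := by exact_mod_cast hn
    have hl : 0 ≤ Real.log (2 * (p n : ℝ)) := Real.log_nonneg (by linarith)
    rw [Real.sq_sqrt (by positivity), mul_div_cancel_left₀ _ two_ne_zero,
      Real.exp_log (by linarith)]
  obtain ⟨hu, hF⟩ := tendsto_mul_corrTail ha hexp (tendsto_log_two_mul_div_sqrt hp hlog) x
  have hlim := tendsto_one_sub_pow hp hF
  refine hlim.congr' ?_
  filter_upwards [hp.eventually_gt_atTop 0, eventually_ge_atTop 3, ha.eventually_gt_atTop 0,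
    ((tendsto_gumbelThreshold_atTop x).comp ha).eventually_gt_atTop 0,
    (tendsto_order.1 hu).2 1 one_pos] with n hpn hn han hs hsn
  have hn' : (0 : ℝ) < n := by exact_mod_cast (by omega : 0 < n)
  simp only [Function.comp] at hs
  rw [← (hnull n).measureReal_spuriousCorr_lt_div_sqrt hn hpn hs ((div_lt_one hn').1 hsn)]
  congr 1
  ext ω
  simp only [Set.mem_ofPred_eq]
  rw [← gumbelCentering_add_div, lt_div_iff₀ (Real.sqrt_pos.2 hn'), ← sub_lt_iff_lt_add',
    lt_div_iff₀ han, mul_comm (spuriousCorr (X n) (ε n) ω),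
    mul_comm (√(2 * Real.log (2 * (p n : ℝ))))]

/-- The relative error of `√(2 log p / n)` as an approximation of the maximum absolute sample
correlation tends to zero in probability. -/
theorem isLittleOPOne_spuriousCorr [∀ n, IsProbabilityMeasure (P n)] (hp : Tendsto p atTop atTop)
    (hlog : (fun n => Real.log (p n)) =o[atTop] (fun n : ℕ => (n : ℝ) ^ (1 / 2 : ℝ)))
    (hnull : ∀ n, IsGaussianNull (X n) (ε n) (P n)) :
    IsLittleOPOne P fun n ω =>
      spuriousCorr (X n) (ε n) ω / √(2 * Real.log (p n) / n) - 1 := by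
  have hγ := fun n => (hnull n).aemeasurable_spuriousCorr
  refine ⟨fun n => ((hγ n).div_const _).sub_const _, fun δ hδ => ?_⟩
  have ha := tendsto_sqrt_log_two_mul hp
  have hlim := tendsto_measureReal_gumbel hp hlog hnull
  set a : ℕ → ℝ := fun n => √(2 * Real.log (2 * (p n : ℝ))) with ha_def
  set W : ∀ n, Ω n → ℝ := fun n ω =>
    a n * (√n * spuriousCorr (X n) (ε n) ω - gumbelCentering (2 * (p n : ℝ))) with hW
  have hWm : ∀ n, AEMeasurable (W n) (P n) := fun n =>
    (((hγ n).const_mul _).sub_const _).const_mul _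
  -- Tightness: the Gumbel mass outside [-M, M) is arbitrarily small, so M can be fixed before n
  -- grows.
  have hG : Tendsto (fun M : ℝ => Real.exp (-Real.exp (-(-M))) +
      (1 - Real.exp (-Real.exp (-M)))) atTop (𝓝 0) := by
    have h1 : Tendsto (fun M : ℝ => Real.exp (-Real.exp (-(-M)))) atTop (𝓝 0) := by
      simp only [neg_neg]
      exact Real.tendsto_exp_neg_atTop_nhds_zero.comp Real.tendsto_exp_atTop
    have h2 : Tendsto (fun M : ℝ => Real.exp (-Real.exp (-M))) atTop (𝓝 1) := by
      have := (Real.continuous_exp.tendsto _).comp Real.tendsto_exp_neg_atTop_nhds_zero.neg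
      simpa [Function.comp_def] using this
    simpa using h1.add (h2.const_sub 1)
  refine tendsto_order.2 ⟨fun η hη => Eventually.of_forall fun n => hη.trans_le measureReal_nonneg,
    fun η hη => ?_⟩
  obtain ⟨M, hM⟩ := ((tendsto_order.1 hG).2 η hη).exists
  have hbound := (tendsto_order.1 ((hlim (-M)).add ((hlim M).const_sub 1))).2 η hM
  have hratio : ∀ y, Tendsto (fun n => gumbelThreshold y (a n) / √(2 * Real.log (p n : ℝ))) atTop
      (𝓝 1) := fun y => by
    have := ((tendsto_gumbelThreshold_div y).comp ha).div
      (tendsto_sqrt_log_div_sqrt_log_two_mul hp) one_ne_zero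
    rw [div_one] at this
    refine this.congr' ?_
    filter_upwards [ha.eventually_gt_atTop 0] with n hn
    exact div_div_div_cancel_right₀ hn.ne' _ _
  filter_upwards [hbound, (tendsto_order.1 (hratio M)).2 (1 + δ) (by linarith),
    (tendsto_order.1 (hratio (-M))).1 (1 - δ) (by linarith), ha.eventually_gt_atTop 0,
    eventually_gt_atTop 0, hp.eventually_gt_atTop 1] with n h1 h2 h3 han hn hpn
  refine lt_of_le_of_lt ?_ h1
  have hn' : (0 : ℝ) < n := by exact_mod_cast hn
  have hpn' : (1 : ℝ) < p n := by exact_mod_cast hpn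
  have hα : 0 < √(2 * Real.log (p n : ℝ)) :=
    Real.sqrt_pos.2 (mul_pos two_pos (Real.log_pos hpn'))
  have hcompl : 1 - (P n).real {ω | W n ω < M} = (P n).real {ω | W n ω < M}ᶜ :=
    (probReal_compl_eq_one_sub₀ ((hWm n).nullMeasurableSet_preimage measurableSet_Iio)).symm
  have hWlt : ∀ y ω, W n ω < y ↔
      √n * spuriousCorr (X n) (ε n) ω < gumbelThreshold y (a n) := fun y ω => by
    rw [ha_def, ← gumbelCentering_add_div, ← sub_lt_iff_lt_add', lt_div_iff₀ han, mul_comm]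
  rw [hcompl]
  -- A relative error of at least δ forces W ≥ M or W < -M, since both thresholds lie within a
  -- factor 1 ± δ of √(2 log p).
  refine (measureReal_mono fun ω hω => ?_).trans (measureReal_union_le _ _)
  rw [div_lt_iff₀ hα] at h2
  rw [lt_div_iff₀ hα] at h3
  have hR : spuriousCorr (X n) (ε n) ω / √(2 * Real.log (p n) / n) =
      √n * spuriousCorr (X n) (ε n) ω / √(2 * Real.log (p n)) := by
    rw [Real.sqrt_div' _ hn'.le]
    field_simp
  simp only [Set.mem_ofPred_eq, hR, le_abs] at hω
  rcases hω with h | h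
  · refine Or.inr fun hlt => ?_
    have hlt' := (hWlt M ω).1 hlt
    have : 1 + δ ≤ √n * spuriousCorr (X n) (ε n) ω / √(2 * Real.log (p n)) := by linarith
    rw [le_div_iff₀ hα] at this
    linarith
  · refine Or.inl ((hWlt (-M) ω).2 ?_)
    have : √n * spuriousCorr (X n) (ε n) ω / √(2 * Real.log (p n)) ≤ 1 - δ := by linarith
    rw [div_le_iff₀ hα] at this
    linarith

end

theorem mainTheorem6 {Ω : ℕ → Type*} [∀ n, MeasurableSpace (Ω n)]
    (P : ∀ n, Measure (Ω n)) [∀ n, IsProbabilityMeasure (P n)]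
    (p : ℕ → ℕ) (hp : Tendsto p atTop atTop)
    (hlog : (fun n => Real.log (p n)) =o[atTop] (fun n : ℕ => (n : ℝ) ^ (1 / 2 : ℝ)))
    (X : ∀ n, Fin n → Fin (p n) → Ω n → ℝ) (ε : ∀ n, Fin n → Ω n → ℝ)
    (hnull : ∀ n, IsGaussianNull (X n) (ε n) (P n)) :
    (∃ R : ∀ n, Ω n → ℝ, IsLittleOPOne P R ∧
      ∀ᶠ n in atTop, ∀ ω : Ω n,
        spuriousCorr (X n) (ε n) ω = Real.sqrt (2 * Real.log (p n) / n) * (1 + R n ω)) ∧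
    (∀ x : ℝ, Tendsto
      (fun n => (P n).real {ω |
        Real.sqrt (2 * Real.log (2 * (p n : ℝ))) *
          (Real.sqrt n * spuriousCorr (X n) (ε n) ω - gumbelCentering (2 * (p n : ℝ))) < x})
      atTop (𝓝 (Real.exp (-Real.exp (-x))))) := by
  refine ⟨⟨_, isLittleOPOne_spuriousCorr hp hlog hnull, ?_⟩,
    tendsto_measureReal_gumbel hp hlog hnull⟩
  -- The factorization divides by √(2 log p / n), which is positive only once n > 0 and p > 1.
  filter_upwards [eventually_gt_atTop 0, hp.eventually_gt_atTop 1] with n hn hpn ω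
  have hn' : (0 : ℝ) < n := by exact_mod_cast hn
  have hpn' : (1 : ℝ) < p n := by exact_mod_cast hpn
  have hα : 0 < √(2 * Real.log (p n : ℝ) / n) :=
    Real.sqrt_pos.2 (div_pos (mul_pos two_pos (Real.log_pos hpn')) hn')
  rw [add_sub_cancel, mul_div_cancel₀ _ hα.ne']
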